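/- Let $A=\varinjlim(A_n,\varphi_n)$ be an AH-algebra with generalized diagonal connecting maps, that is: * $A_n=\bigoplus_{i=1}^{N_n}A_n^i$ with $A_n^i=p_n^i\,(C(Z_n^i)\otimes M_{r_n^i})\,p_n^i$, where each $Z_n^i$ is a connected compact Hausdorff space and $p_n^i\in C(Z_n^i)\otimes M_{r_n^i}$ is a projection, with a given decomposition $p_n^i=\sum_{k=1}^{\operatorname{rank}(p_n^i)}p_{n,k}^i$ into mutually orthogonal line bundles (projections all of whose fibres have rank one); * the $\varphi_n:A_n\to A_{n+1}$ are unital injective $*$-homomorphisms whose components $\varphi_n^{ji}:A_n^i\to A_{n+1}^j$ have the form $\varphi_n^{ji}(a)=\sum_{y\in\mathcal Y(n,(j,i))}(a\circ\lambda_y)\otimes q_y$, where $\mathcal Y(n,(j,i))$ is a finite set, each $\lambda_y:Z_{n+1}^j\to Z_n^i$ is continuous, each $q_y\in C(Z_{n+1}^j)\otimes M_{s_n^{ji}}$ is either $0$ or a line bundle, $r_{n+1}^j=\sum_i r_n^is_n^{ji}$, and $\bigoplus_i M_{r_n^i}\otimes M_{s_n^{ji}}$ is embedded block-diagonally in $M_{r_{n+1}^j}$;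 * the decompositions are compatible with the connecting maps: whenever $q_y\neq0$, each line bundle $(p_{n,k}^i\circ\lambda_y)\otimes q_y$ is one of the $p_{n+1,l}^j$. Let $C_n=\bigoplus_i\bigoplus_k p_{n,k}^i(C(Z_n^i)\otimes M_{r_n^i})p_{n,k}^i\subseteq A_n$ and let $C_A=\varinjlim(C_n,\varphi_n)\subseteq A$ be the associated C$^*$-diagonal. The labelled Bratteli diagram $\mathcal B_A$ has, at level $n$, one node for each summand $A_n^i$, and, for every $y\in\mathcal Y(n,(j,i))$ with $q_y\ne0$ and every $k\le\operatorname{rank}(p_n^i)$, one arrow $(y,k)$ labelled $\lambda_y$ from the node $A_n^i$ to the node $A_{n+1}^j$. The arrow $(y,k)$ is said to start at the line bundle $p_{n,k}^i$ and to end at the line bundle $(p_{n,k}^i\circ\lambda_y)\otimes q_y$ of $A_{n+1}^j$. An infinite path is a sequence of arrows, one from each level to the next, beginning at the first level, in which every arrow starts at the node, and at the line bundle, at which the preceding arrow ends. For an infinite path $p$ with labels $\lambda_{y_1},\lambda_{y_2},\dots$, let $\varprojlim p$ be the inverse limit of the base spaces of the nodes on $p$ along the maps $\lambda_{y_n}$,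 with its inverse limit topology. Let $P_{\mathcal B_A}$ be the set of infinite paths, and give $\bigsqcup_{p\in P_{\mathcal B_A}}\varprojlim p$ the coarsest topology for which, for every $n$, the $n$-th arrow of $p$ (in a discrete set) and the $n$-th coordinate of $z$ depend continuously on $(p,z)$. Then there is a homeomorphism $$\operatorname{Spec}(C_A)\;\cong\;\bigsqcup_{p\in P_{\mathcal B_A}}\varprojlim p,$$ under which the connected components of $\operatorname{Spec}(C_A)$ are exactly the sets $\varprojlim p$, $p\in P_{\mathcal B_A}$; moreover the subspace topology of each component is the inverse limit topology of $\varprojlim p$. -/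

import Mathlib

open Filter Topology
open scoped Matrix.Norms.L2Operator

universe u

noncomputable section

/-! ## Corners of C*-algebras -/

section Corner

variable {R : Type*} [CStarAlgebra R] {p : R}

/-- The set `pRp`, for a projection `p`, as a (not necessarily unital) *-subalgebra of `R`. -/
def cornerSubalgebra (hp : IsStarProjection p) : NonUnitalStarSubalgebra ℂ R where
  carrier := {a | p * a = a ∧ a * p = a}
  add_mem' := by
    rintro a b ⟨ha, ha'⟩ ⟨hb, hb'⟩
    exact ⟨by rw [mul_add, ha, hb], by rw [add_mul, ha', hb']⟩
  zero_mem' := ⟨mul_zero _, zero_mul _⟩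
  mul_mem' := by
    rintro a b ⟨ha, ha'⟩ ⟨hb, hb'⟩
    exact ⟨by rw [← mul_assoc, ha], by rw [mul_assoc, hb']⟩
  smul_mem' := by
    rintro c a ⟨ha, ha'⟩
    exact ⟨by rw [mul_smul_comm, ha], by rw [smul_mul_assoc, ha']⟩
  star_mem' := by
    rintro a ⟨ha, ha'⟩
    have hs : star p = p := hp.isSelfAdjoint
    refine ⟨?_, ?_⟩
    · have := congrArg star ha'
      rwa [star_mul, hs] at this
    · have := congrArg star ha
      rwa [star_mul, hs] at this

theorem mem_cornerSubalgebra_iff (hp : IsStarProjection p) (a : R) :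
    a ∈ cornerSubalgebra hp ↔ ∃ b, a = p * b * p := by
  have hi : p * p = p := hp.isIdempotentElem
  constructor
  · rintro ⟨h, h'⟩
    exact ⟨a, by rw [h, h']⟩
  · rintro ⟨b, rfl⟩
    exact ⟨by simp only [← mul_assoc, hi], by simp only [mul_assoc, hi]⟩

theorem isClosed_cornerSubalgebra (hp : IsStarProjection p) :
    IsClosed (cornerSubalgebra hp : Set R) := by
  have : (cornerSubalgebra hp : Set R) = {a | p * a = a} ∩ {a | a * p = a} := rfl
  rw [this]
  exact (isClosed_eq (by fun_prop) continuous_id).inter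
    (isClosed_eq (by fun_prop) continuous_id)

/-- The corner `pRp`, a unital C*-algebra with unit `p`. -/
def Corner (hp : IsStarProjection p) : Type _ := cornerSubalgebra hp

/-- The inclusion `pRp ⊆ R`. -/
def Corner.val {hp : IsStarProjection p} (a : Corner hp) : R := Subtype.val a

instance (hp : IsStarProjection p) : NonUnitalCStarAlgebra (Corner hp) :=
  NonUnitalStarSubalgebra.nonUnitalCStarAlgebra (cornerSubalgebra hp)
    (h_closed := isClosed_cornerSubalgebra hp)

instance (hp : IsStarProjection p) : NormedRing (Corner hp) where
  __ := (inferInstance : NonUnitalNormedRing (Corner hp))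
  one := ⟨p, hp.isIdempotentElem, hp.isIdempotentElem⟩
  one_mul a := Subtype.ext a.2.1
  mul_one a := Subtype.ext a.2.2

instance (hp : IsStarProjection p) : CStarAlgebra (Corner hp) where
  __ := (inferInstance : NonUnitalCStarAlgebra (Corner hp))
  __ := (inferInstance : NormedRing (Corner hp))
  __ := Algebra.ofModule (R := ℂ) (A := Corner hp) smul_mul_assoc mul_smul_comm
  norm_smul_le := norm_smul_le

@[simp] theorem Corner.val_one {hp : IsStarProjection p} : (1 : Corner hp).val = p := rfl
@[simp] theorem Corner.val_mul {hp : IsStarProjection p} (a b : Corner hp) :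
    (a * b).val = a.val * b.val := rfl
@[simp] theorem Corner.val_add {hp : IsStarProjection p} (a b : Corner hp) :
    (a + b).val = a.val + b.val := rfl
@[simp] theorem Corner.val_star {hp : IsStarProjection p} (a : Corner hp) :
    (star a).val = star a.val := rfl
@[simp] theorem Corner.val_smul {hp : IsStarProjection p} (c : ℂ) (a : Corner hp) :
    (c • a).val = c • a.val := rfl
theorem Corner.norm_val {hp : IsStarProjection p} (a : Corner hp) : ‖a.val‖ = ‖a‖ := rfl
theorem Corner.val_injective {hp : IsStarProjection p} :
    Function.Injective (Corner.val : Corner hp → R) := Subtype.val_injective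

end Corner

/-! ## Inductive limits of C*-algebras

The C*-algebraic inductive limit of a sequence `A 0 → A 1 → A 2 → ⋯` is the (Hausdorff)
completion of the *-algebra of all sequences `a ∈ ∏ₙ A n` with `a (n + 1) = φ n (a n)` for all
large `n`, in the C*-seminorm `a ↦ lim ‖a n‖`. -/

section InductiveLimit

variable {A : ℕ → Type u} [∀ n, CStarAlgebra (A n)] (φ : ∀ n, A n →⋆ₐ[ℂ] A (n + 1))

/-- The *-algebra of eventually coherent sequences. -/
def coherentSeq : StarSubalgebra ℂ (∀ n, A n) where
  carrier := {a | ∀ᶠ n in atTop, a (n + 1) = φ n (a n)}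
  add_mem' := by
    intro a b ha hb
    filter_upwards [ha, hb] with n h1 h2
    simp [h1, h2]
  mul_mem' := by
    intro a b ha hb
    filter_upwards [ha, hb] with n h1 h2
    simp [h1, h2]
  algebraMap_mem' c := Eventually.of_forall fun n => by
    simp only [Pi.algebraMap_apply]
    exact ((φ n).toAlgHom.commutes c).symm
  star_mem' := by
    intro a ha
    filter_upwards [ha] with n h1
    simp [h1, map_star]

/-- The type of eventually coherent sequences, carrying the seminorm `lim ‖a n‖`. -/
def PreLimit : Type u := coherentSeq φ

namespace PreLimit

instance : Ring (PreLimit φ) := inferInstanceAs (Ring (coherentSeq φ))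
instance : StarRing (PreLimit φ) := inferInstanceAs (StarRing (coherentSeq φ))
instance : Algebra ℂ (PreLimit φ) := inferInstanceAs (Algebra ℂ (coherentSeq φ))
instance : StarModule ℂ (PreLimit φ) := inferInstanceAs (StarModule ℂ (coherentSeq φ))

/-- The `n`-th entry of a sequence. -/
def entry (a : PreLimit φ) (n : ℕ) : A n := (show coherentSeq φ from a).1 n

variable {φ}

theorem exists_tendsto (a : PreLimit φ) : ∃ l, Tendsto (fun n => ‖a.entry φ n‖) atTop (𝓝 l) := by
  obtain ⟨N, hN⟩ := eventually_atTop.1 (show ∀ᶠ n in atTop, a.entry φ (n + 1) = φ n (a.entry φ n)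
    from (show coherentSeq φ from a).2)
  have hanti : Antitone fun n => ‖a.entry φ (n + N)‖ := antitone_nat_of_succ_le fun n => by
    have h := hN (n + N) (by omega)
    rw [show n + 1 + N = n + N + 1 by omega, h]
    exact NonUnitalStarAlgHom.norm_apply_le (φ (n + N)) _
  exact ⟨_, (tendsto_add_atTop_iff_nat N).1 (tendsto_atTop_ciInf hanti
    ⟨0, by rintro _ ⟨n, rfl⟩; exact norm_nonneg _⟩)⟩

theorem tendsto_norm (a : PreLimit φ) : Tendsto (fun n => ‖a.entry φ n‖) atTop
    (𝓝 (limUnder atTop fun n => ‖a.entry φ n‖)) :=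
  tendsto_nhds_limUnder (exists_tendsto a)

variable (φ)

/-- The C*-seminorm `a ↦ lim ‖a n‖`. -/
def limNorm : RingSeminorm (PreLimit φ) where
  toFun a := limUnder atTop fun n => ‖a.entry φ n‖
  map_zero' := (Tendsto.congr (fun n => (norm_zero (E := A n)).symm)
    tendsto_const_nhds).limUnder_eq
  add_le' a b := le_of_tendsto_of_tendsto' (tendsto_norm (a + b))
    ((tendsto_norm a).add (tendsto_norm b)) fun n => norm_add_le (a.entry φ n) (b.entry φ n)
  neg' a := congrArg (limUnder atTop) (funext fun n => norm_neg (a.entry φ n))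
  mul_le' a b := le_of_tendsto_of_tendsto' (tendsto_norm (a * b))
    ((tendsto_norm a).mul (tendsto_norm b)) fun n => norm_mul_le (a.entry φ n) (b.entry φ n)

instance : SeminormedRing (PreLimit φ) := (limNorm φ).toSeminormedRing

variable {φ}

theorem tendsto_norm' (a : PreLimit φ) : Tendsto (fun n => ‖a.entry φ n‖) atTop (𝓝 ‖a‖) :=
  tendsto_norm a

instance : NormedAlgebra ℂ (PreLimit φ) where
  norm_smul_le c a := le_of_tendsto_of_tendsto' (tendsto_norm (c • a))
    ((tendsto_norm a).const_mul ‖c‖) fun n => norm_smul_le c (a.entry φ n)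

instance : NormedStarGroup (PreLimit φ) where
  norm_star_le a := le_of_tendsto_of_tendsto' (tendsto_norm (star a)) (tendsto_norm a)
    fun n => (norm_star (a.entry φ n)).le

theorem norm_star_mul_self' (a : PreLimit φ) : ‖star a * a‖ = ‖a‖ * ‖a‖ :=
  tendsto_nhds_unique (tendsto_norm' (star a * a))
    (Tendsto.congr (fun n => (CStarRing.norm_star_mul_self (x := a.entry φ n)).symm)
      ((tendsto_norm' a).mul (tendsto_norm' a)))

end PreLimit

/-- The inductive limit C*-algebra `lim (A n, φ n)`. -/
def CStarLimit : Type u := UniformSpace.Completion (PreLimit φ)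

namespace CStarLimit

open UniformSpace

instance : NormedRing (CStarLimit φ) :=
  inferInstanceAs (NormedRing (Completion (PreLimit φ)))
instance : CompleteSpace (CStarLimit φ) :=
  inferInstanceAs (CompleteSpace (Completion (PreLimit φ)))
instance : Algebra ℂ (CStarLimit φ) :=
  inferInstanceAs (Algebra ℂ (Completion (PreLimit φ)))

/-- The class of an eventually coherent sequence in the inductive limit. -/
def mk (a : PreLimit φ) : CStarLimit φ := (a : Completion (PreLimit φ))

variable {φ}

theorem denseRange_mk : DenseRange (mk φ) := Completion.denseRange_coe
theorem continuous_mk : Continuous (mk φ) := Completion.continuous_coe _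
theorem mk_add (a b : PreLimit φ) : mk φ (a + b) = mk φ a + mk φ b := Completion.coe_add a b
theorem mk_mul (a b : PreLimit φ) : mk φ (a * b) = mk φ a * mk φ b := Completion.coe_mul a b
theorem mk_smul (c : ℂ) (a : PreLimit φ) : mk φ (c • a) = c • mk φ a := Completion.coe_smul c a
theorem norm_mk (a : PreLimit φ) : ‖mk φ a‖ = ‖a‖ := Completion.norm_coe a

instance : NormedAlgebra ℂ (CStarLimit φ) where
  norm_smul_le c x := norm_smul_le c (show Completion (PreLimit φ) from x)

instance : Star (CStarLimit φ) :=
  ⟨fun x => Completion.map (star : PreLimit φ → PreLimit φ) x⟩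

theorem continuous_star' : Continuous (star : CStarLimit φ → CStarLimit φ) :=
  Completion.continuous_map

theorem mk_star (a : PreLimit φ) : mk φ (star a) = star (mk φ a) :=
  (Completion.map_coe (starNormedAddGroupHom (E := PreLimit φ)).uniformContinuous a).symm

instance : StarRing (CStarLimit φ) where
  star_involutive x := denseRange_mk.induction_on (p := fun x => star (star x) = x) x
    (isClosed_eq (continuous_star'.comp continuous_star') continuous_id)
    fun a => by rw [← mk_star, ← mk_star, star_star]
  star_mul x y := denseRange_mk.induction_on₂ (p := fun x y => star (x * y) = star y * star x)
    (isClosed_eq (continuous_star'.comp (by fun_prop))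
      ((continuous_star'.comp continuous_snd).mul (continuous_star'.comp continuous_fst)))
    (fun a b => by rw [← mk_mul, ← mk_star, ← mk_star, ← mk_star, star_mul, mk_mul]) x y
  star_add x y := denseRange_mk.induction_on₂ (p := fun x y => star (x + y) = star x + star y)
    (isClosed_eq (continuous_star'.comp (by fun_prop))
      ((continuous_star'.comp continuous_fst).add (continuous_star'.comp continuous_snd)))
    (fun a b => by rw [← mk_add, ← mk_star, ← mk_star, ← mk_star, star_add, mk_add]) x y

instance : CStarRing (CStarLimit φ) where
  norm_mul_self_le x := denseRange_mk.induction_on (p := fun x => ‖x‖ * ‖x‖ ≤ ‖star x * x‖) x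
    (isClosed_le (by fun_prop) (continuous_norm.comp (continuous_star'.mul continuous_id)))
    fun a => by rw [← mk_star, ← mk_mul, norm_mk, norm_mk, PreLimit.norm_star_mul_self']

theorem star_smul' (c : ℂ) (x : CStarLimit φ) : star (c • x) = star c • star x :=
  denseRange_mk.induction_on (p := fun x => star (c • x) = star c • star x) x
    (isClosed_eq (continuous_star'.comp (continuous_const_smul c))
      (continuous_star'.const_smul (star c)))
    fun a => by rw [← mk_smul, ← mk_star, ← mk_star, star_smul, mk_smul]

instance : CStarAlgebra (CStarLimit φ) where
  star_smul := star_smul'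

end CStarLimit

/-- The inductive limit, inside `lim (A n, φ n)`, of C*-subalgebras `C n ⊆ A n`: the closure of the
set of classes of those coherent sequences whose entries eventually lie in `C n`.  (When
`φ n (C n) ⊆ C (n + 1)`, this is the closure of the union of the images of the `C n`.) -/
def CStarLimit.ofSubalgebras (C : ∀ n, StarSubalgebra ℂ (A n)) :
    StarSubalgebra ℂ (CStarLimit φ) :=
  StarSubalgebra.topologicalClosure
    { carrier := {x | ∃ a : PreLimit φ, (∀ᶠ n in atTop, a.entry φ n ∈ C n) ∧ CStarLimit.mk φ a = x}
      add_mem' := by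
        rintro _ _ ⟨a, ha, rfl⟩ ⟨b, hb, rfl⟩
        refine ⟨a + b, ?_, CStarLimit.mk_add a b⟩
        filter_upwards [ha, hb] with n h1 h2 using add_mem h1 h2
      mul_mem' := by
        rintro _ _ ⟨a, ha, rfl⟩ ⟨b, hb, rfl⟩
        refine ⟨a * b, ?_, CStarLimit.mk_mul a b⟩
        filter_upwards [ha, hb] with n h1 h2 using mul_mem h1 h2
      algebraMap_mem' := fun c =>
        ⟨algebraMap ℂ _ c, Eventually.of_forall fun n => algebraMap_mem (C n) c, rfl⟩
      star_mem' := by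
        rintro _ ⟨a, ha, rfl⟩
        refine ⟨star a, ?_, CStarLimit.mk_star a⟩
        filter_upwards [ha] with n h1 using star_mem h1 }

end InductiveLimit

/-! ## AH-systems with generalized diagonal connecting maps -/

/-- The algebra `C(Z) ⊗ M_r` of continuous functions from `Z` to the C*-algebra of complex
`r × r` matrices (with the operator norm). -/
abbrev MatrixFunctions (Z : Type*) [TopologicalSpace Z] (r : ℕ) : Type _ :=
  C(Z, Matrix (Fin r) (Fin r) ℂ)

/-- A projection in `C(Z) ⊗ M_r` is a line bundle when all its fibres have rank one. -/
def IsLineBundle {Z : Type*} [TopologicalSpace Z] {r : ℕ} (q : MatrixFunctions Z r) : Prop :=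
  IsStarProjection q ∧ ∀ x, (q x).rank = 1

/-- The `*`-isomorphic copy of `⨁ᵢ M_{r i} ⊗ M_{s i}` inside `M_t`, where `t = ∑ᵢ r i * s i`:
block diagonal matrices, the index set of `M_t` being identified with the disjoint union
of the index sets of the blocks through `e`. -/
def blockMatrix {N t : ℕ} {r s : Fin N → ℕ} (e : (Σ i, Fin (r i) × Fin (s i)) ≃ Fin t)
    (M : ∀ i, Matrix (Fin (r i) × Fin (s i)) (Fin (r i) × Fin (s i)) ℂ) :
    Matrix (Fin t) (Fin t) ℂ :=
  Matrix.reindex e e (Matrix.blockDiagonal' M)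

/-- `a ⊗ q ∈ M_r ⊗ M_s`. -/
def tensorMatrix {r s : ℕ} (a : Matrix (Fin r) (Fin r) ℂ) (q : Matrix (Fin s) (Fin s) ℂ) :
    Matrix (Fin r × Fin s) (Fin r × Fin s) ℂ :=
  Matrix.kronecker a q

/-- The building blocks of an AH-algebra, together with line bundle decompositions of the
projections `p n i`. -/
structure BuildingBlocks where
  /-- number of summands of the `n`-th building block -/
  N : ℕ → ℕ
  /-- the base spaces -/
  Z : ∀ n, Fin (N n) → Type u
  [topologicalSpace : ∀ n i, TopologicalSpace (Z n i)]
  [compactSpace : ∀ n i, CompactSpace (Z n i)]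
  [t2Space : ∀ n i, T2Space (Z n i)]
  [connectedSpace : ∀ n i, ConnectedSpace (Z n i)]
  /-- matrix sizes -/
  r : ∀ n, Fin (N n) → ℕ
  /-- the projections cutting down `C(Z n i) ⊗ M_{r n i}` -/
  p : ∀ n i, MatrixFunctions (Z n i) (r n i)
  isStarProjection_p : ∀ n i, IsStarProjection (p n i)
  /-- the rank of `p n i` -/
  rank : ∀ n, Fin (N n) → ℕ
  /-- the line bundles into which `p n i` decomposes -/
  line : ∀ n i, Fin (rank n i) → MatrixFunctions (Z n i) (r n i)
  isLineBundle_line : ∀ n i k, IsLineBundle (line n i k)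
  line_mul_line : ∀ n i k l, k ≠ l → line n i k * line n i l = 0
  sum_line : ∀ n i, ∑ k, line n i k = p n i

attribute [instance] BuildingBlocks.topologicalSpace BuildingBlocks.compactSpace
  BuildingBlocks.t2Space BuildingBlocks.connectedSpace

namespace BuildingBlocks

variable (B : BuildingBlocks.{u})

/-- The `n`-th building block `A_n = ⨁ᵢ p_n^i (C(Z_n^i) ⊗ M_{r_n^i}) p_n^i`. -/
def Alg (n : ℕ) : Type u := ∀ i, Corner (B.isStarProjection_p n i)

instance (n : ℕ) : CStarAlgebra (B.Alg n) :=
  inferInstanceAs (CStarAlgebra (∀ i, Corner (B.isStarProjection_p n i)))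

variable {B} in
/-- The component in the summand number `i` of an element of `A_n`, as a matrix-valued function. -/
def Alg.comp {n : ℕ} (a : B.Alg n) (i : Fin (B.N n)) : MatrixFunctions (B.Z n i) (B.r n i) :=
  (a i).val

variable {B} in
theorem Alg.comp_add {n : ℕ} (a b : B.Alg n) (i : Fin (B.N n)) :
    (a + b).comp i = a.comp i + b.comp i := rfl
variable {B} in
theorem Alg.comp_mul {n : ℕ} (a b : B.Alg n) (i : Fin (B.N n)) :
    (a * b).comp i = a.comp i * b.comp i := rfl
variable {B} in
theorem Alg.comp_star {n : ℕ} (a : B.Alg n) (i : Fin (B.N n)) :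
    (star a).comp i = star (a.comp i) := rfl
theorem Alg.comp_algebraMap {n : ℕ} (c : ℂ) (i : Fin (B.N n)) :
    (algebraMap ℂ (B.Alg n) c).comp i = c • B.p n i := rfl

/-- The subalgebra `C_n = ⨁ᵢ ⨁ₖ p_{n,k}^i (C(Z_n^i) ⊗ M_{r_n^i}) p_{n,k}^i` of `A_n`. -/
def diag (n : ℕ) : StarSubalgebra ℂ (B.Alg n) where
  carrier := {a | ∀ i, ∃ b : Fin (B.rank n i) → MatrixFunctions (B.Z n i) (B.r n i),
    a.comp i = ∑ k, B.line n i k * b k * B.line n i k}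
  add_mem' := by
    intro a a' ha ha' i
    obtain ⟨b, hb⟩ := ha i
    obtain ⟨b', hb'⟩ := ha' i
    refine ⟨b + b', ?_⟩
    rw [Alg.comp_add, hb, hb', ← Finset.sum_add_distrib]
    exact Finset.sum_congr rfl fun k _ => by rw [Pi.add_apply, mul_add, add_mul]
  mul_mem' := by
    intro a a' ha ha' i
    obtain ⟨b, hb⟩ := ha i
    obtain ⟨b', hb'⟩ := ha' i
    refine ⟨fun k => b k * B.line n i k * b' k, ?_⟩
    rw [Alg.comp_mul, hb, hb', Finset.sum_mul_sum]
    refine Finset.sum_congr rfl fun k _ => ?_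
    rw [Finset.sum_eq_single k]
    · have h : B.line n i k * B.line n i k = B.line n i k :=
        (B.isLineBundle_line n i k).1.isIdempotentElem
      calc B.line n i k * b k * B.line n i k * (B.line n i k * b' k * B.line n i k)
          = B.line n i k * b k * (B.line n i k * B.line n i k) * b' k * B.line n i k := by
            simp only [mul_assoc]
        _ = B.line n i k * (b k * B.line n i k * b' k) * B.line n i k := by
            rw [h]; simp only [mul_assoc]
    · intro l _ hl
      calc B.line n i k * b k * B.line n i k * (B.line n i l * b' l * B.line n i l)
          = B.line n i k * b k * (B.line n i k * B.line n i l) * b' l * B.line n i l := by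
            simp only [mul_assoc]
        _ = 0 := by rw [B.line_mul_line n i k l hl.symm]; simp
    · simp
  algebraMap_mem' := by
    intro c i
    refine ⟨fun k => c • B.line n i k, ?_⟩
    rw [Alg.comp_algebraMap, ← B.sum_line, Finset.smul_sum]
    refine Finset.sum_congr rfl fun k _ => ?_
    have h : B.line n i k * B.line n i k = B.line n i k :=
      (B.isLineBundle_line n i k).1.isIdempotentElem
    rw [mul_smul_comm, smul_mul_assoc, h, h]
  star_mem' := by
    intro a ha i
    obtain ⟨b, hb⟩ := ha i
    refine ⟨star b, ?_⟩
    rw [Alg.comp_star, hb, star_sum]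
    refine Finset.sum_congr rfl fun k _ => ?_
    have h : star (B.line n i k) = B.line n i k := (B.isLineBundle_line n i k).1.isSelfAdjoint
    rw [star_mul, star_mul, h, Pi.star_apply, mul_assoc]

end BuildingBlocks

/-- A sequence of building blocks with unital injective connecting maps of generalized diagonal
form `φ_n^{ji}(a) = ∑_y (a ∘ λ_y) ⊗ q_y`. -/
structure GeneralizedDiagonalSystem extends BuildingBlocks.{u} where
  /-- the connecting maps, unital *-homomorphisms -/
  φ : ∀ n, toBuildingBlocks.Alg n →⋆ₐ[ℂ] toBuildingBlocks.Alg (n + 1)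
  injective_φ : ∀ n, Function.Injective (φ n)
  /-- the sizes of the matrix algebras containing the `q_y` -/
  s : ∀ n, Fin (N (n + 1)) → Fin (N n) → ℕ
  /-- the identification of the indices of `M_{r_{n+1}^j}` with those of
  `⨁ᵢ M_{r_n^i} ⊗ M_{s_n^{ji}}`; in particular `r_{n+1}^j = ∑ᵢ r_n^i s_n^{ji}` -/
  idx : ∀ n j, (Σ i, Fin (r n i) × Fin (s n j i)) ≃ Fin (r (n + 1) j)
  /-- the index sets `𝒴(n,(j,i))` -/
  Y : ∀ n, Fin (N (n + 1)) → Fin (N n) → Type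
  [fintypeY : ∀ n j i, Fintype (Y n j i)]
  /-- the eigenvalue functions `λ_y` -/
  eigenmap : ∀ {n j i}, Y n j i → C(Z (n + 1) j, Z n i)
  /-- the projections `q_y` -/
  q : ∀ {n j i}, Y n j i → MatrixFunctions (Z (n + 1) j) (s n j i)
  q_spec : ∀ {n j i} (y : Y n j i), q y = 0 ∨ IsLineBundle (q y)
  φ_apply : ∀ n (a : toBuildingBlocks.Alg n) (j : Fin (N (n + 1))) (x : Z (n + 1) j),
    (φ n a).comp j x =
      blockMatrix (idx n j) fun i => ∑ y : Y n j i, tensorMatrix (a.comp i (eigenmap y x)) (q y x)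
  /-- The decompositions into line bundles are compatible with the connecting maps: each line bundle
  `(p_{n,k}^i ∘ λ_y) ⊗ q_y` is one of the line bundles into which `p_{n+1}^j` decomposes. -/
  exists_line_eq : ∀ n j i (y : Y n j i) (k : Fin (rank n i)), q y ≠ 0 →
    ∃ l : Fin (rank (n + 1) j), ∀ x, line (n + 1) j l x =
      blockMatrix (idx n j) (Pi.single i (tensorMatrix (line n i k (eigenmap y x)) (q y x)))

attribute [instance] GeneralizedDiagonalSystem.fintypeY

namespace GeneralizedDiagonalSystem

variable (S : GeneralizedDiagonalSystem.{u})

/-- The AH-algebra `A = lim (A_n, φ_n)`. -/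
abbrev AHAlgebra : Type u := CStarLimit S.φ

/-- The associated C*-diagonal `C_A = lim (C_n, φ_n)` of `A`. -/
def diagonal : StarSubalgebra ℂ S.AHAlgebra := CStarLimit.ofSubalgebras S.φ S.diag

/-- The arrows of the labelled Bratteli diagram from level `n` to level `n + 1`: for every
`y ∈ 𝒴(n,(j,i))` with `q_y ≠ 0` there are `rank (p_n^i)` arrows from the node `i` to the node `j`,
numbered by the line bundles `p_{n,k}^i`, all with label `λ_y`. -/
structure Arrow (n : ℕ) where
  source : Fin (S.N n)
  target : Fin (S.N (n + 1))
  y : S.Y n target source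
  q_ne_zero : S.q y ≠ 0
  k : Fin (S.rank n source)

/-- An infinite path in the Bratteli diagram: a sequence of arrows in which the `n`-th arrow goes
from `node n` to `node (n + 1)`, is labelled by `λ_{y n}` and starts at the line bundle number
`k n` of `node n`.  It ends at the line bundle `(p_{n,k} ∘ λ_{y}) ⊗ q_y` of `node (n + 1)`, and
that has to be the one where the next arrow starts. -/
structure Path where
  node : ∀ n, Fin (S.N n)
  y : ∀ n, S.Y n (node (n + 1)) (node n)
  q_ne_zero : ∀ n, S.q (y n) ≠ 0
  k : ∀ n, Fin (S.rank n (node n))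
  line_succ : ∀ n x, S.line (n + 1) (node (n + 1)) (k (n + 1)) x =
    blockMatrix (S.idx n (node (n + 1))) (Pi.single (node n)
      (tensorMatrix (S.line n (node n) (k n) (S.eigenmap (y n) x)) (S.q (y n) x)))

variable {S}

/-- The `n`-th arrow of an infinite path. -/
def Path.arrow (p : S.Path) (n : ℕ) : S.Arrow n where
  source := p.node n
  target := p.node (n + 1)
  y := p.y n
  q_ne_zero := p.q_ne_zero n
  k := p.k n

/-- The inverse limit of the base spaces along an infinite path, with the inverse limit topology
(the topology of a subspace of the product). -/
def Path.InverseLimit (p : S.Path) : Type u :=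
  {z : ∀ n, S.Z n (p.node n) // ∀ n, S.eigenmap (p.y n) (z (n + 1)) = z n}

instance (p : S.Path) : TopologicalSpace p.InverseLimit :=
  instTopologicalSpaceSubtype

variable (S)

/-- The disjoint union of the inverse limits over all infinite paths. -/
def PathSpace : Type u := Σ p : S.Path, p.InverseLimit

/-- The topology of the disjoint union: the coarsest one in which, for each `n`, the `n`-th arrow of
the path (in a discrete set) and the `n`-th coordinate of the point depend continuously on the
point.  A basis is given by the sets of the pairs `(p, z)` for which `p` lies in a given
cylinder set (first arrows prescribed) and `z n` in a given open subset of `Z n (p.node n)`. -/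
instance : TopologicalSpace S.PathSpace :=
  TopologicalSpace.induced
    (fun w n => (⟨w.1.arrow n, w.2.1 n⟩ : Σ e : S.Arrow n, S.Z n e.source)) inferInstance

end GeneralizedDiagonalSystem

end

/-!
The diagonal subalgebra `C_n` of a building block is the algebra of continuous functions on a
compact Hausdorff space `Spectrum n`, the disjoint union of one copy of `Z n i` for each line bundle
`line n i k`: a corner `P M_r P` by a rank one projection `P` consists of the multiples
`tr (P b) P` of `P`, so an element of `C_n` is a sum `∑ₖ f_k p_{n,k}^i` with scalar functions `f_k`
(`mem_diag_iff`).

The connecting map sends `∑ₖ f_k p_{n,k}^i` to the sum of the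
`(f_k ∘ λ_y) ((p_{n,k}^i ∘ λ_y) ⊗ q_y)`. These line bundles are among the `p_{n+1,l}^j`, and
unitality forces each `p_{n+1,l}^j` to occur exactly once (`existsUnique_endsAt`). Hence exactly one
arrow ends at each line bundle, and the restriction `C_n → C_{n+1}` of `φ n` is dual to the map
`specMap : Spectrum (n + 1) → Spectrum n` that follows this arrow backwards (`φ_ofSpectrum`).

So the spectrum of `C_A` is the inverse limit of the spaces `Spectrum n` (`characterSpaceHomeo`). A
character restricts to each `C_n`, and is determined by its restrictions because the images of the
`C_n` are dense; conversely a coherent sequence of points gives vector states of the `A_n`, whose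
limit along an ultrafilter is multiplicative on `C_A`. A coherent sequence of points of the
`Spectrum n` is in turn the same as an infinite path together with a point of its inverse limit, and
the topologies agree because the `n`-th arrow is a locally constant function of the point of
`Spectrum (n + 1)` (`pathSpaceHomeo`).

Finally, the inverse limit along a path is connected, being an inverse limit of connected compact
Hausdorff spaces (`isConnected_setOf_coherent`), while different paths are separated by the line
bundles that they visit, which are locally constant; so these inverse limits are the components.
-/

noncomputable section

/-! ### Matrices -/

theorem Matrix.exists_eq_vecMulVec_of_rank_eq_one {m n : Type*} [Fintype m] [Fintype n]
    [DecidableEq n] {K : Type*} [Field K] {P : Matrix m n K} (hP : P.rank = 1) :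
    ∃ v w, P = Matrix.vecMulVec v w := by
  obtain ⟨v, -, hv⟩ := finrank_eq_one_iff'.1 hP
  choose c hc using hv
  refine ⟨v.1, fun j => c ⟨P.mulVecLin (Pi.single j 1), LinearMap.mem_range_self _ _⟩, ?_⟩
  ext i j
  have h := congrFun (congrArg Subtype.val
    (hc ⟨P.mulVecLin (Pi.single j 1), LinearMap.mem_range_self _ _⟩)) i
  have h1 : (P.mulVecLin (Pi.single j 1)) i = P i j := by simp
  rw [Matrix.vecMulVec_apply, mul_comm, ← h1]
  exact h.symm

theorem Matrix.mul_mul_self_eq_trace_smul {n : Type*} [Fintype n] [DecidableEq n] {K : Type*}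
    [Field K] {P : Matrix n n K} (hP : P.rank = 1) (b : Matrix n n K) :
    P * b * P = (P * b).trace • P := by
  obtain ⟨v, w, rfl⟩ := Matrix.exists_eq_vecMulVec_of_rank_eq_one hP
  rw [Matrix.vecMulVec_mul, Matrix.vecMulVec_mul_vecMulVec, Matrix.trace_vecMulVec,
    dotProduct_comm]
  ext i j
  simp [Matrix.vecMulVec_apply]
  ring

theorem Matrix.norm_trace_mul_le_of_rank_eq_one {n : Type*} [Fintype n] [DecidableEq n]
    {P : Matrix n n ℂ} (hP : IsStarProjection P) (hr : P.rank = 1) (b : Matrix n n ℂ) :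
    ‖(P * b).trace‖ ≤ ‖b‖ := by
  have hne : P ≠ 0 := by
    rintro rfl
    simp at hr
  have h1 : ‖P‖ = 1 := by
    have h := CStarRing.norm_star_mul_self (x := P)
    rw [hP.isSelfAdjoint.star_eq, hP.isIdempotentElem.eq] at h
    have := norm_ne_zero_iff.2 hne
    field_simp at h
    exact h.symm
  have h2 := congrArg norm (Matrix.mul_mul_self_eq_trace_smul hr b)
  rw [norm_smul, h1, mul_one] at h2
  calc ‖(P * b).trace‖ = ‖P * b * P‖ := h2.symm
    _ ≤ ‖P‖ * ‖b‖ * ‖P‖ := norm_mul₃_le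
    _ = ‖b‖ := by rw [h1, one_mul, mul_one]

theorem blockMatrix_sum {N t : ℕ} {r s : Fin N → ℕ} (e : (Σ i, Fin (r i) × Fin (s i)) ≃ Fin t)
    {W : Fin N → Type*} [∀ i, Fintype (W i)]
    (g : ∀ i, W i → Matrix (Fin (r i) × Fin (s i)) (Fin (r i) × Fin (s i)) ℂ) :
    blockMatrix e (fun i => ∑ w, g i w) =
      ∑ w : Σ i, W i, blockMatrix e (Pi.single w.1 (g w.1 w.2)) := by
  have hadd : ∀ M M', blockMatrix e (M + M') = blockMatrix e M + blockMatrix e M' := fun M M' => by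
    rw [blockMatrix, Matrix.blockDiagonal'_add]; rfl
  let F : (∀ i, Matrix (Fin (r i) × Fin (s i)) (Fin (r i) × Fin (s i)) ℂ) →+
      Matrix (Fin t) (Fin t) ℂ := AddMonoidHom.mk' (blockMatrix e) hadd
  change F _ = ∑ w : Σ i, W i, F _
  rw [← map_sum, Fintype.sum_sigma]
  congr 1
  funext i
  rw [Finset.sum_apply, Finset.sum_eq_single i]
  · simp
  · intro j _ hj
    simp [hj]
  · simp

theorem blockMatrix_smul {N t : ℕ} {r s : Fin N → ℕ}
    (e : (Σ i, Fin (r i) × Fin (s i)) ≃ Fin t) (c : ℂ)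
    (M : ∀ i, Matrix (Fin (r i) × Fin (s i)) (Fin (r i) × Fin (s i)) ℂ) :
    blockMatrix e (c • M) = c • blockMatrix e M := by
  rw [blockMatrix, Matrix.blockDiagonal'_smul]; rfl

/-! ### Inverse limits of connected compact Hausdorff spaces -/

section InverseLimit

/-- A decreasing intersection of connected compact sets in a Hausdorff space is connected. -/
theorem isConnected_iInter_of_antitone {X : Type*} [TopologicalSpace X] [T2Space X]
    (K : ℕ → Set X) (hanti : Antitone K) (hc : ∀ n, IsCompact (K n))
    (hconn : ∀ n, IsConnected (K n)) : IsConnected (⋂ n, K n) := by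
  have hcl : ∀ n, IsClosed (K n) := fun n => (hc n).isClosed
  have hcpt : IsCompact (⋂ n, K n) := (hc 0).of_isClosed_subset (isClosed_iInter hcl)
    (Set.iInter_subset K 0)
  refine ⟨IsCompact.nonempty_iInter_of_sequence_nonempty_isCompact_isClosed K
    (fun n => hanti n.le_succ) (fun n => (hconn n).1) (hc 0) hcl, ?_⟩
  rw [isPreconnected_closed_iff]
  intro F G hF hG hFG hneF hneG
  by_contra hne
  rw [Set.not_nonempty_iff_eq_empty] at hne
  -- Disjoint neighbourhoods of the two halves already cover some `K n`.
  obtain ⟨U, V, hU, hV, hFU, hGV, hUV⟩ := SeparatedNhds.of_isCompact_isCompact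
    (hcpt.inter_right hF) (hcpt.inter_right hG) (by
      rw [Set.disjoint_iff]
      rintro x ⟨⟨h1, h2⟩, -, h3⟩
      exact hne.subset ⟨h1, h2, h3⟩)
  have hsub : ⋂ n, K n ⊆ U ∪ V := fun x hx => (hFG hx).imp (fun h => hFU ⟨hx, h⟩)
    fun h => hGV ⟨hx, h⟩
  obtain ⟨n, hn⟩ := exists_subset_nhds_of_isCompact hanti.directed_ge hc
    (fun x hx => (hU.union hV).mem_nhds (hsub hx))
  have hmem : ∀ x ∈ ⋂ n, K n, x ∈ K n := fun x hx => Set.mem_iInter.1 hx n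
  obtain ⟨x, hx, hxF⟩ := hneF
  obtain ⟨y, hy, hyG⟩ := hneG
  obtain ⟨z, -, hzU, hzV⟩ := (hconn n).2 U V hU hV hn ⟨x, hmem x hx, hFU ⟨hx, hxF⟩⟩
    ⟨y, hmem y hy, hGV ⟨hy, hyG⟩⟩
  exact Set.disjoint_iff.1 hUV ⟨hzU, hzV⟩

variable {X : ℕ → Type*} [∀ n, TopologicalSpace (X n)] (f : ∀ n, C(X (n + 1), X n))

/-- The points of `∏ₙ X n` that are coherent below level `n`. -/
def coherentBelow (n : ℕ) : Set (∀ n, X n) := {z | ∀ m < n, f m (z (m + 1)) = z m}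

theorem isClosed_coherentBelow [∀ n, T2Space (X n)] (n : ℕ) : IsClosed (coherentBelow f n) := by
  simp only [coherentBelow, Set.ofPred_forall]
  exact isClosed_biInter fun m _ => isClosed_eq (by fun_prop) (by fun_prop)

/-- The coordinates from `n` on of a point coherent below `n` are arbitrary and determine the
others, so that `coherentBelow f n` is a retract of the connected space `∏ₙ X n`. -/
theorem isConnected_coherentBelow [∀ n, ConnectedSpace (X n)] (n : ℕ) :
    IsConnected (coherentBelow f n) := by
  -- By induction there is a retraction of the product onto `coherentBelow f n`, changing only
  -- coordinates below `n`.
  suffices h : ∃ g : (∀ n, X n) → ∀ n, X n, Continuous g ∧ (∀ z m, n ≤ m → g z m = z m) ∧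
      (∀ z, g z ∈ coherentBelow f n) ∧ ∀ z ∈ coherentBelow f n, g z = z by
    obtain ⟨g, hg, -, h1, h2⟩ := h
    have : coherentBelow f n = Set.range g :=
      Set.Subset.antisymm (fun z hz => ⟨z, h2 z hz⟩) (by rintro _ ⟨z, rfl⟩; exact h1 z)
    rw [this]
    exact isConnected_range hg
  induction n with
  | zero => exact ⟨id, continuous_id, fun _ _ _ => rfl, fun _ m hm => absurd hm m.not_lt_zero,
      fun _ _ => rfl⟩
  | succ n ih =>
    obtain ⟨g, hg, hge, h1, h2⟩ := ih
    refine ⟨fun z => g (Function.update z n (f n (z (n + 1)))),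
      hg.comp (continuous_id.update n (by fun_prop)), fun z m hm => ?_, fun z m hm => ?_,
      fun z hz => ?_⟩
    · exact (hge _ m (by omega)).trans (Function.update_of_ne (by omega) _ _)
    · rcases Nat.lt_succ_iff_lt_or_eq.1 hm with h | rfl
      · exact h1 _ m h
      · beta_reduce
        rw [hge _ (m + 1) (by omega), hge _ m le_rfl, Function.update_of_ne (by omega),
          Function.update_self]
    · have h3 : Function.update z n (f n (z (n + 1))) = z := by
        rw [hz n n.lt_succ_self, Function.update_eq_self]
      change g (Function.update z n (f n (z (n + 1)))) = z
      rw [h3]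
      exact h2 z fun m hm => hz m (by omega)

theorem isConnected_setOf_coherent [∀ n, CompactSpace (X n)] [∀ n, T2Space (X n)]
    [∀ n, ConnectedSpace (X n)] : IsConnected {z : ∀ n, X n | ∀ n, f n (z (n + 1)) = z n} := by
  have : {z : ∀ n, X n | ∀ n, f n (z (n + 1)) = z n} = ⋂ n, coherentBelow f n := by
    ext z
    simp only [coherentBelow, Set.mem_ofPred_eq, Set.mem_iInter]
    exact ⟨fun h n m _ => h m, fun h n => h (n + 1) n n.lt_succ_self⟩
  rw [this]
  exact isConnected_iInter_of_antitone _ (fun m n hmn z hz k hk => hz k (hk.trans_le hmn))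
    (fun n => (isClosed_coherentBelow f n).isCompact) (isConnected_coherentBelow f)

end InverseLimit

/-! ### The canonical maps into an inductive limit -/

namespace CStarLimit

variable {A : ℕ → Type u} [∀ n, CStarAlgebra (A n)] {φ : ∀ n, A n →⋆ₐ[ℂ] A (n + 1)}

theorem mk_eq_mk_of_eventually_eq {a b : PreLimit φ}
    (h : ∀ᶠ n in atTop, a.entry φ n = b.entry φ n) : mk φ a = mk φ b := by
  have hn : mk φ (a + (-1 : ℂ) • b) = 0 := by
    rw [← norm_eq_zero, norm_mk]
    refine tendsto_nhds_unique (PreLimit.tendsto_norm' _) (tendsto_const_nhds.congr' ?_)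
    filter_upwards [h] with n hn
    change (0 : ℝ) = ‖a.entry φ n + (-1 : ℂ) • b.entry φ n‖
    rw [hn]
    simp
  rw [mk_add, mk_smul, neg_one_smul] at hn
  exact add_neg_eq_zero.1 hn

variable (φ) in
/-- The entries of the sequence `0, …, 0, a, φ a, φ (φ a), …` with `a` in position `n`. -/
def tailEntry (n : ℕ) (a : A n) : ∀ m, A m
  | 0 => if h : n = 0 then h ▸ a else 0
  | m + 1 => if h : n = m + 1 then h ▸ a else φ m (tailEntry n a m)

theorem tailEntry_self (n : ℕ) (a : A n) : tailEntry φ n a n = a := by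
  cases n <;> simp [tailEntry]

theorem tailEntry_succ {n m : ℕ} (h : n ≤ m) (a : A n) :
    tailEntry φ n a (m + 1) = φ m (tailEntry φ n a m) := by
  rw [tailEntry, dif_neg (by omega)]

variable (φ) in
/-- The eventually coherent sequence `0, …, 0, a, φ a, φ (φ a), …` with `a` in position `n`. -/
def tail (n : ℕ) (a : A n) : PreLimit φ :=
  show coherentSeq φ from ⟨tailEntry φ n a, eventually_atTop.2 ⟨n, fun _ hm => tailEntry_succ hm a⟩⟩

theorem entry_tail_self (n : ℕ) (a : A n) : (tail φ n a).entry φ n = a := tailEntry_self n a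

theorem entry_tail_succ {n m : ℕ} (h : n ≤ m) (a : A n) :
    (tail φ n a).entry φ (m + 1) = φ m ((tail φ n a).entry φ m) := tailEntry_succ h a

theorem mk_eq_mk_tail {a : PreLimit φ} {n : ℕ}
    (h : ∀ m, n ≤ m → a.entry φ (m + 1) = φ m (a.entry φ m)) :
    mk φ a = mk φ (tail φ n (a.entry φ n)) := by
  refine mk_eq_mk_of_eventually_eq (eventually_atTop.2 ⟨n, fun m hm => ?_⟩)
  induction m, hm using Nat.le_induction with
  | base => rw [entry_tail_self]
  | succ m hm ih => rw [h m hm, entry_tail_succ hm, ih]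

variable (φ) in
/-- The canonical homomorphism from the `n`-th algebra to the inductive limit. -/
def of (n : ℕ) : A n →⋆ₐ[ℂ] CStarLimit φ where
  toFun a := mk φ (tail φ n a)
  map_one' := by
    have := mk_eq_mk_tail (φ := φ) (a := 1) (n := n) fun m _ => (map_one (φ m)).symm
    exact this.symm
  map_zero' := by
    have := mk_eq_mk_tail (φ := φ) (a := 0) (n := n) fun m _ => (map_zero (φ m)).symm
    exact this.symm
  map_mul' a b := by
    rw [← mk_mul]
    refine ((mk_eq_mk_tail (φ := φ) (n := n) fun m hm => ?_).trans ?_).symm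
    · change (tail φ n a).entry φ (m + 1) * (tail φ n b).entry φ (m + 1) =
        φ m ((tail φ n a).entry φ m * (tail φ n b).entry φ m)
      rw [entry_tail_succ hm, entry_tail_succ hm, map_mul]
    · change mk φ (tail φ n ((tail φ n a).entry φ n * (tail φ n b).entry φ n)) = _
      rw [entry_tail_self, entry_tail_self]
  map_add' a b := by
    rw [← mk_add]
    refine ((mk_eq_mk_tail (φ := φ) (n := n) fun m hm => ?_).trans ?_).symm
    · change (tail φ n a).entry φ (m + 1) + (tail φ n b).entry φ (m + 1) =
        φ m ((tail φ n a).entry φ m + (tail φ n b).entry φ m)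
      rw [entry_tail_succ hm, entry_tail_succ hm, map_add]
    · change mk φ (tail φ n ((tail φ n a).entry φ n + (tail φ n b).entry φ n)) = _
      rw [entry_tail_self, entry_tail_self]
  commutes' c := by
    have := mk_eq_mk_tail (φ := φ) (a := algebraMap ℂ (PreLimit φ) c) (n := n)
      fun m _ => ((φ m).toAlgHom.commutes c).symm
    exact this.symm
  map_star' a := by
    rw [← mk_star]
    refine ((mk_eq_mk_tail (φ := φ) (n := n) fun m hm => ?_).trans ?_).symm
    · change star ((tail φ n a).entry φ (m + 1)) = φ m (star ((tail φ n a).entry φ m))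
      rw [entry_tail_succ hm, map_star]
    · change mk φ (tail φ n (star ((tail φ n a).entry φ n))) = _
      rw [entry_tail_self]

theorem of_apply (n : ℕ) (a : A n) : of φ n a = mk φ (tail φ n a) := rfl

theorem of_succ (n : ℕ) (a : A n) : of φ (n + 1) (φ n a) = of φ n a := by
  rw [of_apply, of_apply, mk_eq_mk_tail (a := tail φ n a) (n := n + 1)
    fun m hm => entry_tail_succ (by omega) a, entry_tail_succ le_rfl, entry_tail_self]

/-- A sequence of contractive functionals on the `A n` has a limit functional on the inductive
limit, which takes the values that are eventually constant along coherent sequences. It is obtained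
as a limit along an ultrafilter. -/
theorem exists_limit_functional (g : ∀ n, A n →ₗ[ℂ] ℂ) (hg : ∀ n a, ‖g n a‖ ≤ ‖a‖) :
    ∃ G : CStarLimit φ →L[ℂ] ℂ, ∀ (a : PreLimit φ) (c : ℂ),
      (∀ᶠ n in atTop, g n (a.entry φ n) = c) → G (mk φ a) = c := by
  let U : Ultrafilter ℕ := Filter.hyperfilter ℕ
  have hU : (U : Filter ℕ) ≤ atTop := by
    rw [← Nat.cofinite_eq_atTop]; exact Filter.hyperfilter_le_cofinite
  have hex : ∀ a : PreLimit φ, ∃ l, Tendsto (fun n => g n (a.entry φ n)) U (𝓝 l) := by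
    intro a
    obtain ⟨C, hC⟩ : ∃ C, ∀ᶠ n in (U : Filter ℕ), ‖a.entry φ n‖ ≤ C :=
      ⟨‖a‖ + 1, hU ((PreLimit.tendsto_norm' a).eventually (Iic_mem_nhds (by linarith)))⟩
    obtain ⟨l, -, hl⟩ := (isCompact_closedBall (0 : ℂ) C).ultrafilter_le_nhds
      (U.map fun n => g n (a.entry φ n)) (by
        rw [Ultrafilter.coe_map, le_principal_iff, mem_map]
        filter_upwards [hC] with n hn
        rw [Set.mem_preimage, mem_closedBall_zero_iff]
        exact (hg n _).trans hn)
    exact ⟨l, hl⟩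
  choose l hl using hex
  let L : PreLimit φ →ₗ[ℂ] ℂ :=
    { toFun := l
      map_add' := fun a b => tendsto_nhds_unique (hl (a + b))
        (((hl a).add (hl b)).congr fun n => (map_add (g n) _ _).symm)
      map_smul' := fun c a => tendsto_nhds_unique (hl (c • a))
        (((hl a).const_smul c).congr fun n => (map_smul (g n) c _).symm) }
  let L' : PreLimit φ →L[ℂ] ℂ := L.mkContinuous 1 fun a => by
    rw [one_mul]
    exact le_of_tendsto_of_tendsto (hl a).norm ((PreLimit.tendsto_norm' a).mono_left hU)
      (Eventually.of_forall fun n => hg n _)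
  let ι : PreLimit φ →L[ℂ] CStarLimit φ :=
    { toFun := mk φ
      map_add' := mk_add
      map_smul' := mk_smul
      cont := continuous_mk }
  have hι : IsUniformInducing ι := UniformSpace.Completion.isUniformInducing_coe _
  refine ⟨L'.extend ι, fun a c h => ?_⟩
  have h1 : L'.extend ι (mk φ a) = L' a :=
    ContinuousLinearMap.extend_eq L' (e := ι) denseRange_mk hι a
  rw [h1]
  exact tendsto_nhds_unique (hl a) (tendsto_const_nhds.congr' (by
    filter_upwards [hU h] with n hn using hn.symm))

end CStarLimit

/-! ### The diagonal subalgebras of the building blocks -/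

namespace BuildingBlocks

variable (B : BuildingBlocks.{u}) {n : ℕ}

/-- The spectrum of the diagonal subalgebra of the `n`-th building block: one copy of the base space
`Z n i` for each line bundle `line n i k`. -/
abbrev Spectrum (n : ℕ) : Type u := Σ v : Σ i, Fin (B.rank n i), B.Z n v.1

variable {B}

theorem line_apply_mul_self {i : Fin (B.N n)} (k : Fin (B.rank n i)) (x : B.Z n i) :
    B.line n i k x * B.line n i k x = B.line n i k x :=
  congrArg (fun f => f x) (B.isLineBundle_line n i k).1.isIdempotentElem.eq

theorem line_apply_mul_of_ne {i : Fin (B.N n)} {k l : Fin (B.rank n i)} (h : k ≠ l) (x : B.Z n i) :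
    B.line n i k x * B.line n i l x = 0 :=
  congrArg (fun f => f x) (B.line_mul_line n i k l h)

theorem star_line_apply {i : Fin (B.N n)} (k : Fin (B.rank n i)) (x : B.Z n i) :
    star (B.line n i k x) = B.line n i k x :=
  congrArg (fun f => f x) (B.isLineBundle_line n i k).1.isSelfAdjoint.star_eq

theorem line_apply_ne_zero {i : Fin (B.N n)} (k : Fin (B.rank n i)) (x : B.Z n i) :
    B.line n i k x ≠ 0 := by
  intro h
  have := (B.isLineBundle_line n i k).2 x
  simp [h] at this

theorem sum_line_apply (i : Fin (B.N n)) (x : B.Z n i) :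
    ∑ k, B.line n i k x = B.p n i x := by
  rw [← B.sum_line n i, ContinuousMap.sum_apply]

theorem trace_line_apply {i : Fin (B.N n)} (k : Fin (B.rank n i)) (x : B.Z n i) :
    (B.line n i k x).trace = 1 := by
  have h := Matrix.mul_mul_self_eq_trace_smul ((B.isLineBundle_line n i k).2 x) 1
  rw [mul_one, line_apply_mul_self] at h
  have h' : (1 - (B.line n i k x).trace) • B.line n i k x = 0 := by
    rw [sub_smul, one_smul, ← h, sub_self]
  exact (sub_eq_zero.1 ((smul_eq_zero.1 h').resolve_right (line_apply_ne_zero k x))).symm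

theorem line_apply_mul_sum {i : Fin (B.N n)} (k : Fin (B.rank n i)) (c : Fin (B.rank n i) → ℂ)
    (x : B.Z n i) : B.line n i k x * ∑ l, c l • B.line n i l x = c k • B.line n i k x := by
  rw [Finset.mul_sum, Finset.sum_eq_single k]
  · rw [mul_smul_comm, line_apply_mul_self]
  · intro l _ hl
    rw [mul_smul_comm, line_apply_mul_of_ne hl.symm, smul_zero]
  · simp

theorem sum_line_apply_mul_sum {i : Fin (B.N n)} (c d : Fin (B.rank n i) → ℂ) (x : B.Z n i) :
    (∑ k, c k • B.line n i k x) * ∑ k, d k • B.line n i k x =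
      ∑ k, (c k * d k) • B.line n i k x := by
  rw [Finset.sum_mul]
  exact Finset.sum_congr rfl fun k _ => by rw [smul_mul_assoc, line_apply_mul_sum, smul_smul]

theorem Alg.ext {a b : B.Alg n} (h : ∀ i x, a.comp i x = b.comp i x) : a = b :=
  funext fun i => Corner.val_injective (ContinuousMap.ext (h i))

variable (n) in
/-- The identification of `C(Spectrum n)` with the diagonal subalgebra of `A_n`, as a homomorphism
into `A_n`: a family of functions `f_{i,k}` is sent to `⨁ᵢ ∑ₖ f_{i,k} p_{n,k}^i`. -/
def ofSpectrum : C(B.Spectrum n, ℂ) →⋆ₐ[ℂ] B.Alg n where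
  toFun f i := ⟨⟨fun x => ∑ k, f ⟨⟨i, k⟩, x⟩ • B.line n i k x, by
      have (k : Fin (B.rank n i)) : Continuous fun x => f ⟨⟨i, k⟩, x⟩ :=
        f.continuous.comp (continuous_sigmaMk (σ := fun v : Σ i, Fin (B.rank n i) => B.Z n v.1))
      exact continuous_finsetSum _ fun k _ => (this k).smul (map_continuous (B.line n i k))⟩, by
    constructor <;> ext1 x
    · have := sum_line_apply_mul_sum (B := B) (fun _ => 1) (fun k => f ⟨⟨i, k⟩, x⟩) x
      simp only [one_smul, one_mul, sum_line_apply] at this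
      exact this
    · have := sum_line_apply_mul_sum (B := B) (fun k => f ⟨⟨i, k⟩, x⟩) (fun _ => 1) x
      simp only [one_smul, mul_one, sum_line_apply] at this
      exact this⟩
  map_one' := Alg.ext fun i x => by
    change ∑ k, (1 : ℂ) • B.line n i k x = B.p n i x
    simp only [one_smul, sum_line_apply]
  map_mul' f g := Alg.ext fun i x => (sum_line_apply_mul_sum (B := B)
    (fun k => f ⟨⟨i, k⟩, x⟩) (fun k => g ⟨⟨i, k⟩, x⟩) x).symm
  map_zero' := Alg.ext fun i x => by
    change ∑ k, (0 : ℂ) • B.line n i k x = 0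
    simp
  map_add' f g := Alg.ext fun i x => by
    change ∑ k, (f ⟨⟨i, k⟩, x⟩ + g ⟨⟨i, k⟩, x⟩) • B.line n i k x =
      ∑ k, f ⟨⟨i, k⟩, x⟩ • B.line n i k x + ∑ k, g ⟨⟨i, k⟩, x⟩ • B.line n i k x
    simp only [add_smul, Finset.sum_add_distrib]
  commutes' c := Alg.ext fun i x => by
    rw [Alg.comp_algebraMap, ContinuousMap.smul_apply, ← sum_line_apply, Finset.smul_sum]
    rfl
  map_star' f := Alg.ext fun i x => by
    change ∑ k, star (f ⟨⟨i, k⟩, x⟩) • B.line n i k x = star (∑ k, f ⟨⟨i, k⟩, x⟩ • B.line n i k x)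
    simp only [star_sum, star_smul, star_line_apply]

theorem ofSpectrum_comp_apply (f : C(B.Spectrum n, ℂ)) (i : Fin (B.N n)) (x : B.Z n i) :
    (ofSpectrum n f).comp i x = ∑ k, f ⟨⟨i, k⟩, x⟩ • B.line n i k x := rfl

theorem mem_diag_iff {a : B.Alg n} : a ∈ B.diag n ↔ ∃ f, ofSpectrum n f = a := by
  constructor
  · intro ha
    choose b hb using ha
    refine ⟨⟨fun t => (B.line n t.1.1 t.1.2 t.2 * b t.1.1 t.1.2 t.2).trace, ?_⟩,
      Alg.ext fun i x => ?_⟩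
    · refine continuous_sigma fun v => ?_
      have h : Continuous (B.line n v.1 v.2 * b v.1 v.2) := map_continuous _
      exact h.matrix_trace
    · rw [ofSpectrum_comp_apply, hb, ContinuousMap.sum_apply]
      exact Finset.sum_congr rfl fun k _ =>
        (Matrix.mul_mul_self_eq_trace_smul ((B.isLineBundle_line n i k).2 x) _).symm
  · rintro ⟨f, rfl⟩ i
    refine ⟨fun k => ⟨fun x => f ⟨⟨i, k⟩, x⟩ • B.line n i k x, ?_⟩, ?_⟩
    · have h : Continuous fun x => f ⟨⟨i, k⟩, x⟩ := f.continuous.comp (continuous_sigmaMk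
        (σ := fun v : Σ i, Fin (B.rank n i) => B.Z n v.1))
      exact h.smul (map_continuous (B.line n i k))
    · ext1 x
      rw [ofSpectrum_comp_apply, ContinuousMap.sum_apply]
      refine Finset.sum_congr rfl fun k _ => ?_
      change _ = B.line n i k x * (f ⟨⟨i, k⟩, x⟩ • B.line n i k x) * B.line n i k x
      rw [mul_smul_comm, smul_mul_assoc, line_apply_mul_self, line_apply_mul_self]

/-- The vector state `a ↦ tr (p_{n,k}^i(x) a(x))` of `A_n`. On the diagonal subalgebra it is the
character given by the point `t = (i, k, x)` of the spectrum. -/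
def lineState (t : B.Spectrum n) : B.Alg n →ₗ[ℂ] ℂ where
  toFun a := (B.line n t.1.1 t.1.2 t.2 * a.comp t.1.1 t.2).trace
  map_add' a b := by
    rw [Alg.comp_add, ContinuousMap.add_apply, mul_add, Matrix.trace_add]
  map_smul' c a := by
    change (B.line n t.1.1 t.1.2 t.2 * (c • a.comp t.1.1 t.2)).trace = _
    rw [mul_smul_comm, Matrix.trace_smul, RingHom.id_apply]

theorem lineState_ofSpectrum (t : B.Spectrum n) (f : C(B.Spectrum n, ℂ)) :
    lineState t (ofSpectrum n f) = f t := by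
  change (B.line n t.1.1 t.1.2 t.2 * (ofSpectrum n f).comp t.1.1 t.2).trace = _
  rw [ofSpectrum_comp_apply, line_apply_mul_sum, Matrix.trace_smul, trace_line_apply, smul_eq_mul,
    mul_one]

theorem norm_lineState_le (t : B.Spectrum n) (a : B.Alg n) : ‖lineState t a‖ ≤ ‖a‖ := by
  have hP : IsStarProjection (B.line n t.1.1 t.1.2 t.2) :=
    ⟨line_apply_mul_self _ _, star_line_apply _ _⟩
  calc ‖lineState t a‖ ≤ ‖a.comp t.1.1 t.2‖ :=
        Matrix.norm_trace_mul_le_of_rank_eq_one hP ((B.isLineBundle_line n t.1.1 t.1.2).2 t.2) _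
    _ ≤ ‖a.comp t.1.1‖ := (a.comp t.1.1).norm_coe_le_norm t.2
    _ = ‖(show ∀ i, Corner (B.isStarProjection_p n i) from a) t.1.1‖ := Corner.norm_val _
    _ ≤ ‖a‖ := norm_le_pi_norm (show ∀ i, Corner (B.isStarProjection_p n i) from a) t.1.1

end BuildingBlocks

/-! ### The maps between the spectra of the diagonal subalgebras -/

namespace GeneralizedDiagonalSystem

open BuildingBlocks

variable {S : GeneralizedDiagonalSystem.{u}} {n : ℕ}

/-- The function `(p_{n,k}^i ∘ λ_y) ⊗ q_y` with values in `M_{r_{n+1}^j}`, for `w = (i, y, k)`. -/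
def arrowLine {j : Fin (S.N (n + 1))} (w : Σ i, S.Y n j i × Fin (S.rank n i))
    (x : S.Z (n + 1) j) : Matrix (Fin (S.r (n + 1) j)) (Fin (S.r (n + 1) j)) ℂ :=
  blockMatrix (S.idx n j) (Pi.single w.1
    (tensorMatrix (S.line n w.1 w.2.2 (S.eigenmap w.2.1 x)) (S.q w.2.1 x)))

/-- The arrow given by `w = (i, y, k)` exists and ends at the line bundle `p_{n+1,l}^j`. -/
def EndsAt {j : Fin (S.N (n + 1))} (w : Σ i, S.Y n j i × Fin (S.rank n i))
    (l : Fin (S.rank (n + 1) j)) : Prop :=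
  S.q w.2.1 ≠ 0 ∧ ∀ x, S.line (n + 1) j l x = arrowLine w x

theorem EndsAt.line_unique {j : Fin (S.N (n + 1))} {w : Σ i, S.Y n j i × Fin (S.rank n i)}
    {l l' : Fin (S.rank (n + 1) j)} (h : EndsAt w l) (h' : EndsAt w l') : l = l' := by
  by_contra hne
  obtain ⟨x⟩ := (inferInstance : Nonempty (S.Z (n + 1) j))
  refine line_apply_ne_zero l x ?_
  have h1 := line_apply_mul_of_ne hne x
  rwa [h'.2 x, ← h.2 x, line_apply_mul_self] at h1

theorem arrowLine_eq_zero {j : Fin (S.N (n + 1))} {w : Σ i, S.Y n j i × Fin (S.rank n i)}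
    (hq : S.q w.2.1 = 0) (x : S.Z (n + 1) j) : arrowLine w x = 0 := by
  have h : tensorMatrix (S.line n w.1 w.2.2 (S.eigenmap w.2.1 x)) (S.q w.2.1 x) = 0 := by
    rw [hq]
    exact Matrix.kronecker_zero _
  rw [arrowLine, h, Pi.single_zero, blockMatrix, Matrix.blockDiagonal'_zero]
  rfl

open Classical in
theorem sum_arrowLine_of_endsAt {j : Fin (S.N (n + 1))} (w : Σ i, S.Y n j i × Fin (S.rank n i))
    (x : S.Z (n + 1) j) :
    ∑ l, (if EndsAt w l then arrowLine w x else 0) = arrowLine w x := by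
  by_cases hq : S.q w.2.1 = 0
  · simp [arrowLine_eq_zero hq]
  · obtain ⟨l, hl⟩ := S.exists_line_eq n j w.1 w.2.1 w.2.2 hq
    have hl' : EndsAt w l := ⟨hq, hl⟩
    rw [Finset.sum_eq_single l (fun l' _ hne => if_neg fun h => hne (h.line_unique hl')) (by simp),
      if_pos hl']

theorem φ_ofSpectrum_comp_apply (f : C(S.Spectrum n, ℂ)) (j : Fin (S.N (n + 1)))
    (x : S.Z (n + 1) j) :
    (S.φ n (ofSpectrum n f)).comp j x =
      ∑ w : Σ i, S.Y n j i × Fin (S.rank n i),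
        f ⟨⟨w.1, w.2.2⟩, S.eigenmap w.2.1 x⟩ • arrowLine w x := by
  rw [S.φ_apply]
  have h : ∀ i, ∑ y : S.Y n j i,
      tensorMatrix ((ofSpectrum n f).comp i (S.eigenmap y x)) (S.q y x) =
      ∑ yk : S.Y n j i × Fin (S.rank n i), f ⟨⟨i, yk.2⟩, S.eigenmap yk.1 x⟩ •
        tensorMatrix (S.line n i yk.2 (S.eigenmap yk.1 x)) (S.q yk.1 x) := by
    intro i
    rw [Fintype.sum_prod_type]
    refine Finset.sum_congr rfl fun y _ => ?_
    ext a b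
    simp only [tensorMatrix, Matrix.kronecker, ofSpectrum_comp_apply, Matrix.sum_apply,
      Matrix.smul_apply, Matrix.kroneckerMap_apply, Finset.sum_mul, smul_eq_mul, mul_assoc]
  simp only [h]
  rw [blockMatrix_sum]
  refine Finset.sum_congr rfl fun w _ => ?_
  rw [arrowLine, ← blockMatrix_smul, Pi.single_smul]

/-- Exactly one arrow ends at each line bundle. The projections `(p_{n,k}^i ∘ λ_y) ⊗ q_y` with
`q_y ≠ 0` all occur among the orthogonal projections `p_{n+1,l}^j`, and both families have the
sum `p_{n+1}^j`, as `φ_n` is unital; so each `p_{n+1,l}^j` occurs once. -/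
theorem existsUnique_endsAt (j : Fin (S.N (n + 1))) (l : Fin (S.rank (n + 1) j)) :
    ∃! w : Σ i, S.Y n j i × Fin (S.rank n i), EndsAt w l := by
  classical
  obtain ⟨x⟩ := (inferInstance : Nonempty (S.Z (n + 1) j))
  have hsum : ∑ w : Σ i, S.Y n j i × Fin (S.rank n i), arrowLine w x =
      ∑ l, S.line (n + 1) j l x := by
    have h := φ_ofSpectrum_comp_apply (S := S) (n := n) 1 j x
    rw [map_one, map_one] at h
    simp only [ContinuousMap.one_apply, one_smul] at h
    rw [← h, sum_line_apply]
    rfl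
  have hterm : ∀ w : Σ i, S.Y n j i × Fin (S.rank n i),
      S.line (n + 1) j l x * arrowLine w x = if EndsAt w l then S.line (n + 1) j l x else 0 := by
    intro w
    rw [← sum_arrowLine_of_endsAt w x, Finset.mul_sum, Finset.sum_eq_single l]
    · split_ifs with h
      · rw [← h.2 x, line_apply_mul_self]
      · rw [mul_zero]
    · intro l' _ hne
      split_ifs with h
      · rw [← h.2 x, line_apply_mul_of_ne hne.symm]
      · rw [mul_zero]
    · simp
  -- Multiplying `hsum` by `p_{n+1,l}^j(x)` counts the arrows that end at this line bundle.
  have hcard : (Finset.univ.filter fun w : Σ i, S.Y n j i × Fin (S.rank n i) =>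
      EndsAt w l).card = 1 := by
    have h := congrArg (S.line (n + 1) j l x * ·) hsum
    simp only [Finset.mul_sum] at h
    rw [Finset.sum_congr rfl fun w _ => hterm w, ← Finset.sum_filter, Finset.sum_const,
      Finset.sum_eq_single l (fun l' _ hne => line_apply_mul_of_ne hne.symm x) (by simp),
      line_apply_mul_self, ← Nat.cast_smul_eq_nsmul ℂ] at h
    have h0 := sub_eq_zero.2 h
    nth_rw 2 [← one_smul ℂ (S.line (n + 1) j l x)] at h0
    rw [← sub_smul] at h0
    have := sub_eq_zero.1 ((smul_eq_zero.1 h0).resolve_right (line_apply_ne_zero l x))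
    exact_mod_cast this
  obtain ⟨w, hw⟩ := Finset.card_eq_one.1 hcard
  have hiff : ∀ w', EndsAt w' l ↔ w' = w := fun w' => by
    simpa using Finset.ext_iff.1 hw w'
  exact ⟨w, (hiff w).2 rfl, fun w' h => (hiff w').1 h⟩

/-- The arrow `(i, y, k)` that ends at the line bundle `p_{n+1,l}^j`, where `v = (j, l)`. -/
def arrowTo (v : Σ j, Fin (S.rank (n + 1) j)) : Σ i, S.Y n v.1 i × Fin (S.rank n i) :=
  (existsUnique_endsAt v.1 v.2).choose

theorem arrowTo_endsAt (v : Σ j, Fin (S.rank (n + 1) j)) : EndsAt (S := S) (arrowTo v) v.2 :=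
  (existsUnique_endsAt v.1 v.2).choose_spec.1

theorem EndsAt.eq_arrowTo {j : Fin (S.N (n + 1))} {w : Σ i, S.Y n j i × Fin (S.rank n i)}
    {l : Fin (S.rank (n + 1) j)} (h : EndsAt w l) : w = arrowTo ⟨j, l⟩ :=
  (existsUnique_endsAt j l).unique h (arrowTo_endsAt ⟨j, l⟩)

variable (S n) in
/-- The map between the spectra of the diagonal subalgebras that is dual to `φ n`. -/
def specMap : C(S.Spectrum (n + 1), S.Spectrum n) where
  toFun t := ⟨⟨(arrowTo t.1).1, (arrowTo t.1).2.2⟩, S.eigenmap (arrowTo t.1).2.1 t.2⟩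
  continuous_toFun := continuous_sigma fun v =>
    Continuous.comp (g := Sigma.mk (β := fun v : Σ i, Fin (S.rank n i) => S.Z n v.1)
      ⟨(arrowTo v).1, (arrowTo v).2.2⟩) continuous_sigmaMk (S.eigenmap (arrowTo v).2.1).continuous

theorem EndsAt.specMap_eq {j : Fin (S.N (n + 1))} {w : Σ i, S.Y n j i × Fin (S.rank n i)}
    {l : Fin (S.rank (n + 1) j)} (h : EndsAt w l) (x : S.Z (n + 1) j) :
    specMap S n ⟨⟨j, l⟩, x⟩ = ⟨⟨w.1, w.2.2⟩, S.eigenmap w.2.1 x⟩ := by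
  rw [h.eq_arrowTo]
  rfl

theorem φ_ofSpectrum (f : C(S.Spectrum n, ℂ)) :
    S.φ n (ofSpectrum n f) = ofSpectrum (n + 1) (f.comp (specMap S n)) := by
  classical
  refine Alg.ext fun j x => ?_
  rw [φ_ofSpectrum_comp_apply, ofSpectrum_comp_apply,
    Finset.sum_congr rfl fun w _ => by rw [← sum_arrowLine_of_endsAt w x, Finset.smul_sum],
    Finset.sum_comm]
  refine Finset.sum_congr rfl fun l _ => ?_
  have hl : EndsAt (S := S) (arrowTo ⟨j, l⟩) l := arrowTo_endsAt ⟨j, l⟩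
  rw [Finset.sum_eq_single (arrowTo ⟨j, l⟩) (fun w _ hne => by
    rw [if_neg fun h => hne h.eq_arrowTo, smul_zero]) (by simp), if_pos hl, ← hl.2 x]
  rfl

end GeneralizedDiagonalSystem

namespace GeneralizedDiagonalSystem

open BuildingBlocks WeakDual

variable {S : GeneralizedDiagonalSystem.{u}} {n : ℕ}

/-! ### The spectrum of the diagonal as an inverse limit -/

variable (S) in
/-- The inverse limit of the spectra of the diagonal subalgebras of the building blocks. -/
abbrev SpectrumLimit : Type u :=
  {t : ∀ n, S.Spectrum n // ∀ n, specMap S n (t (n + 1)) = t n}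

theorem exists_entry_tail_eq {m : ℕ} (hm : n ≤ m) (f : C(S.Spectrum n, ℂ)) :
    ∃ g : C(S.Spectrum m, ℂ),
      (CStarLimit.tail S.φ n (ofSpectrum n f)).entry S.φ m = ofSpectrum m g ∧
      ∀ t : S.SpectrumLimit, g (t.1 m) = f (t.1 n) := by
  induction m, hm using Nat.le_induction with
  | base => exact ⟨f, CStarLimit.entry_tail_self _ _, fun _ => rfl⟩
  | succ m hm ih =>
    obtain ⟨g, hg, hgt⟩ := ih
    refine ⟨g.comp (specMap S m), ?_, fun t => ?_⟩
    · rw [CStarLimit.entry_tail_succ hm, hg, φ_ofSpectrum]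
    · rw [ContinuousMap.comp_apply, t.2 m, hgt]

variable (S n) in
/-- The canonical homomorphism from the diagonal `C(Spectrum n)` of `A_n` to the diagonal of the
inductive limit. -/
def diagonalOf : C(S.Spectrum n, ℂ) →⋆ₐ[ℂ] S.diagonal :=
  ((CStarLimit.of S.φ n).comp (ofSpectrum n)).codRestrict S.diagonal fun f =>
    subset_closure ⟨_, eventually_atTop.2 ⟨n, fun _ hm =>
      let ⟨g, hg, _⟩ := exists_entry_tail_eq hm f
      mem_diag_iff.2 ⟨g, hg.symm⟩⟩, rfl⟩

theorem coe_diagonalOf (f : C(S.Spectrum n, ℂ)) :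
    (diagonalOf S n f : S.AHAlgebra) = CStarLimit.of S.φ n (ofSpectrum n f) := rfl

theorem diagonalOf_succ (f : C(S.Spectrum n, ℂ)) :
    diagonalOf S (n + 1) (f.comp (specMap S n)) = diagonalOf S n f := by
  refine Subtype.ext ?_
  rw [coe_diagonalOf, coe_diagonalOf, ← φ_ofSpectrum, CStarLimit.of_succ]

theorem exists_diagonalOf_eq {m : ℕ} (hm : n ≤ m) (f : C(S.Spectrum n, ℂ)) :
    ∃ g : C(S.Spectrum m, ℂ), diagonalOf S m g = diagonalOf S n f := by
  induction m, hm using Nat.le_induction with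
  | base => exact ⟨f, rfl⟩
  | succ m hm ih =>
    obtain ⟨g, hg⟩ := ih
    exact ⟨g.comp (specMap S m), (diagonalOf_succ g).trans hg⟩

theorem denseRange_diagonalOf :
    DenseRange fun w : Σ n, C(S.Spectrum n, ℂ) => diagonalOf S w.1 w.2 := by
  intro x
  rw [closure_subtype]
  refine closure_mono ?_ x.2
  rintro _ ⟨a, ha, rfl⟩
  have hcoh : ∀ᶠ n in atTop, a.entry S.φ (n + 1) = S.φ n (a.entry S.φ n) :=
    (show coherentSeq S.φ from a).2
  obtain ⟨N, hN⟩ := eventually_atTop.1 (ha.and hcoh)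
  obtain ⟨f, hf⟩ := mem_diag_iff.1 (hN N le_rfl).1
  refine ⟨_, ⟨⟨N, f⟩, rfl⟩, ?_⟩
  rw [coe_diagonalOf, hf, CStarLimit.of_apply]
  exact (CStarLimit.mk_eq_mk_tail fun m hm => (hN m hm).2).symm

instance : CompleteSpace S.diagonal :=
  (isClosed_closure : IsClosed (S.diagonal : Set S.AHAlgebra)).completeSpace_coe

/-- The restriction of a character of the diagonal to `C(Spectrum n)`, as a point of
`Spectrum n`. -/
def restrictCharacter (n : ℕ) (χ : characterSpace ℂ S.diagonal) : S.Spectrum n :=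
  (CharacterSpace.homeoEval (S.Spectrum n) ℂ).symm
    (CharacterSpace.compContinuousMap (diagonalOf S n) χ)

theorem continuous_restrictCharacter :
    Continuous (restrictCharacter (S := S) n) :=
  (CharacterSpace.homeoEval (S.Spectrum n) ℂ).symm.continuous.comp (map_continuous _)

theorem apply_restrictCharacter (χ : characterSpace ℂ S.diagonal) (f : C(S.Spectrum n, ℂ)) :
    f (restrictCharacter n χ) = χ (diagonalOf S n f) := by
  have h := (CharacterSpace.homeoEval (S.Spectrum n) ℂ).apply_symm_apply
    (CharacterSpace.compContinuousMap (diagonalOf S n) χ)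
  exact congrArg (fun ψ : characterSpace ℂ C(S.Spectrum n, ℂ) => ψ f) h

theorem eq_of_forall_continuousMap_eq {X : Type*} [TopologicalSpace X] [CompactSpace X]
    [T2Space X] {x y : X} (h : ∀ f : C(X, ℂ), f x = f y) : x = y :=
  (CharacterSpace.homeoEval X ℂ).injective (DFunLike.ext _ _ h)

theorem specMap_restrictCharacter (χ : characterSpace ℂ S.diagonal) :
    specMap S n (restrictCharacter (n + 1) χ) = restrictCharacter n χ :=
  eq_of_forall_continuousMap_eq fun f => by
    have h := apply_restrictCharacter χ (f.comp (specMap S n))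
    rwa [diagonalOf_succ, ← apply_restrictCharacter] at h

/-- A coherent sequence of points of the spectra defines a character of the diagonal: the
restriction of a limit of the corresponding states of the `A_n`. -/
theorem exists_character (t : S.SpectrumLimit) :
    ∃ χ : characterSpace ℂ S.diagonal, ∀ n (f : C(S.Spectrum n, ℂ)),
      χ (diagonalOf S n f) = f (t.1 n) := by
  obtain ⟨G, hG⟩ := CStarLimit.exists_limit_functional (φ := S.φ) (fun n => lineState (t.1 n))
    fun n => norm_lineState_le (t.1 n)
  let F : WeakDual ℂ S.diagonal := StrongDual.toWeakDual
    { toFun := fun x => G x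
      map_add' := fun x y => map_add G _ _
      map_smul' := fun c x => map_smul G c _
      cont := G.continuous.comp continuous_subtype_val }
  have hF : Continuous fun x => F x := G.continuous.comp continuous_subtype_val
  have hval : ∀ n (f : C(S.Spectrum n, ℂ)), F (diagonalOf S n f) = f (t.1 n) := by
    intro n f
    refine hG _ _ (eventually_atTop.2 ⟨n, fun m hm => ?_⟩)
    obtain ⟨g, hg, hgt⟩ := exists_entry_tail_eq hm f
    exact (congrArg (lineState (t.1 m)) hg).trans ((lineState_ofSpectrum _ _).trans (hgt t))
  have hmem : F ∈ characterSpace ℂ S.diagonal := by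
    rw [CharacterSpace.eq_set_map_one_map_mul]
    constructor
    · rw [← map_one (diagonalOf S 0), hval, ContinuousMap.one_apply]
    · intro x y
      refine denseRange_diagonalOf.induction_on₂ (p := fun x y => F (x * y) = F x * F y)
        (isClosed_eq (hF.comp continuous_mul)
          ((hF.comp continuous_fst).mul (hF.comp continuous_snd))) ?_ x y
      rintro ⟨n, f⟩ ⟨m, g⟩
      obtain ⟨f', hf⟩ := exists_diagonalOf_eq (le_max_left n m) f
      obtain ⟨g', hg⟩ := exists_diagonalOf_eq (le_max_right n m) g
      simp only [← hf, ← hg]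
      rw [← map_mul, hval, hval, hval, ContinuousMap.mul_apply]
  exact ⟨⟨F, hmem⟩, hval⟩

variable (S) in
/-- The spectrum of the diagonal is the inverse limit of the spectra of the diagonal subalgebras of
the building blocks. -/
def characterSpaceHomeo : characterSpace ℂ S.diagonal ≃ₜ S.SpectrumLimit :=
  Continuous.homeoOfEquivCompactToT2 (f := Equiv.ofBijective
    (fun χ => (⟨fun n => restrictCharacter n χ, fun _ => specMap_restrictCharacter χ⟩ :
      S.SpectrumLimit)) (by
      constructor
      · intro χ χ' h
        have hd : ∀ w : Σ n, C(S.Spectrum n, ℂ), χ (diagonalOf S w.1 w.2) =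
            χ' (diagonalOf S w.1 w.2) := fun w => by
          rw [← apply_restrictCharacter, ← apply_restrictCharacter]
          exact congrArg w.2 (congrFun (congrArg Subtype.val h) w.1)
        exact DFunLike.coe_injective (denseRange_diagonalOf.equalizer (map_continuous χ)
          (map_continuous χ') (funext hd))
      · intro t
        obtain ⟨χ, hχ⟩ := exists_character t
        refine ⟨χ, Subtype.ext (funext fun n => eq_of_forall_continuousMap_eq fun f => ?_)⟩
        rw [apply_restrictCharacter, hχ]))
    (Continuous.subtype_mk (continuous_pi fun _ => continuous_restrictCharacter) _)

/-! ### The path space as an inverse limit -/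

theorem Path.endsAt (p : S.Path) (n : ℕ) :
    EndsAt (S := S) ⟨p.node n, p.y n, p.k n⟩ (p.k (n + 1)) :=
  ⟨p.q_ne_zero n, p.line_succ n⟩

/-- A path is determined by the line bundles that it visits. -/
theorem Path.ext_line {p p' : S.Path} (h : ∀ n, (⟨p.node n, p.k n⟩ : Σ i, Fin (S.rank n i)) =
    ⟨p'.node n, p'.k n⟩) : p = p' := by
  have hy : ∀ n, EndsAt (S := S) ⟨p.node n, p.y n, p.k n⟩ (p.k (n + 1)) := p.endsAt
  have hy' : ∀ n, EndsAt (S := S) ⟨p'.node n, p'.y n, p'.k n⟩ (p'.k (n + 1)) := p'.endsAt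
  rcases p with ⟨node, y, hq, k, hl⟩
  rcases p' with ⟨node', y', hq', k', hl'⟩
  obtain rfl : node = node' := funext fun n => congrArg Sigma.fst (h n)
  obtain rfl : k = k' := funext fun n => by simpa using h n
  obtain rfl : y = y' := funext fun n => by
    simpa using (hy n).eq_arrowTo.trans (hy' n).eq_arrowTo.symm
  rfl

/-- The point of `Spectrum n` given by the `n`-th line bundle of a path and the `n`-th coordinate
of a point of its inverse limit. -/
def PathSpace.coord (w : S.PathSpace) (n : ℕ) : S.Spectrum n :=
  ⟨⟨w.1.node n, w.1.k n⟩, w.2.1 n⟩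

theorem PathSpace.specMap_coord (w : S.PathSpace) (n : ℕ) :
    specMap S n (w.coord (n + 1)) = w.coord n := by
  rw [coord, (w.1.endsAt n).specMap_eq, w.2.2 n]
  rfl

theorem PathSpace.coord_injective {w w' : S.PathSpace} (h : ∀ n, w.coord n = w'.coord n) :
    w = w' := by
  rcases w with ⟨p, z⟩
  rcases w' with ⟨p', z'⟩
  obtain rfl : p = p' := Path.ext_line fun n => congrArg Sigma.fst (h n)
  obtain rfl : z = z' := Subtype.ext (funext fun n => eq_of_heq (Sigma.mk.inj (h n)).2)
  rfl

theorem exists_arrow_of_specMap_eq {u : S.Spectrum (n + 1)} {t : S.Spectrum n}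
    (h : specMap S n u = t) : ∃ y : S.Y n u.1.1 t.1.1,
      EndsAt (S := S) ⟨t.1.1, y, t.1.2⟩ u.1.2 ∧ S.eigenmap y u.2 = t.2 := by
  subst h
  exact ⟨(arrowTo u.1).2.1, arrowTo_endsAt u.1, rfl⟩

theorem PathSpace.exists_coord_eq (t : S.SpectrumLimit) :
    ∃ w : S.PathSpace, ∀ n, w.coord n = t.1 n := by
  choose y hy hz using fun n => exists_arrow_of_specMap_eq (t.2 n)
  exact ⟨⟨⟨fun n => (t.1 n).1.1, y, fun n => (hy n).1, fun n => (t.1 n).1.2, fun n => (hy n).2⟩,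
    fun n => (t.1 n).2, hz⟩, fun n => rfl⟩

/-- The arrow that ends at the line bundle of a point of `Spectrum (n + 1)`, together with the image
of the base point at the source of this arrow. -/
def arrowMap (t : S.Spectrum (n + 1)) : Σ e : S.Arrow n, S.Z n e.source :=
  ⟨⟨(arrowTo t.1).1, t.1.1, (arrowTo t.1).2.1, (arrowTo_endsAt t.1).1, (arrowTo t.1).2.2⟩,
    S.eigenmap (arrowTo t.1).2.1 t.2⟩

theorem continuous_arrowMap : Continuous (arrowMap (S := S) (n := n)) :=
  continuous_sigma fun v => Continuous.comp
    (g := Sigma.mk (β := fun e : S.Arrow n => S.Z n e.source)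
      ⟨(arrowTo v).1, v.1, (arrowTo v).2.1, (arrowTo_endsAt v).1, (arrowTo v).2.2⟩)
    continuous_sigmaMk (S.eigenmap (arrowTo v).2.1).continuous

theorem EndsAt.arrowMap_eq {j : Fin (S.N (n + 1))} {w : Σ i, S.Y n j i × Fin (S.rank n i)}
    {l : Fin (S.rank (n + 1) j)} (h : EndsAt w l) (x : S.Z (n + 1) j) :
    arrowMap (S := S) (n := n) ⟨⟨j, l⟩, x⟩ =
      ⟨⟨w.1, j, w.2.1, h.1, w.2.2⟩, S.eigenmap w.2.1 x⟩ := by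
  obtain rfl := h.eq_arrowTo
  rfl

theorem PathSpace.arrowMap_coord (w : S.PathSpace) (n : ℕ) :
    arrowMap (w.coord (n + 1)) = ⟨w.1.arrow n, w.2.1 n⟩ := by
  rw [coord, (w.1.endsAt n).arrowMap_eq, w.2.2 n]
  rfl

theorem PathSpace.continuous_arrow (n : ℕ) : Continuous fun w : S.PathSpace =>
    (⟨w.1.arrow n, w.2.1 n⟩ : Σ e : S.Arrow n, S.Z n e.source) :=
  continuous_pi_iff.1 (continuous_induced_dom (f := fun (w : S.PathSpace) n =>
    (⟨w.1.arrow n, w.2.1 n⟩ : Σ e : S.Arrow n, S.Z n e.source))) n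

theorem PathSpace.continuous_coord (n : ℕ) : Continuous fun w : S.PathSpace => w.coord n := by
  let h : (Σ e : S.Arrow n, S.Z n e.source) → S.Spectrum n := fun a => ⟨⟨a.1.source, a.1.k⟩, a.2⟩
  have hh : Continuous h := continuous_sigma fun e =>
    continuous_sigmaMk (σ := fun v : Σ i, Fin (S.rank n i) => S.Z n v.1) (i := ⟨e.source, e.k⟩)
  exact hh.comp (continuous_arrow n)

variable (S) in
/-- The disjoint union of the inverse limits along the paths is the inverse limit of the spectra of
the diagonal subalgebras of the building blocks. -/
def pathSpaceHomeo : S.PathSpace ≃ₜ S.SpectrumLimit where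
  toFun w := ⟨w.coord, w.specMap_coord⟩
  invFun t := (PathSpace.exists_coord_eq t).choose
  left_inv w := PathSpace.coord_injective
    (PathSpace.exists_coord_eq ⟨w.coord, w.specMap_coord⟩).choose_spec
  right_inv t := Subtype.ext (funext (PathSpace.exists_coord_eq t).choose_spec)
  continuous_toFun := Continuous.subtype_mk (continuous_pi PathSpace.continuous_coord) _
  continuous_invFun := by
    refine continuous_induced_rng.2 (continuous_pi fun n => ?_)
    have h : Continuous fun t : S.SpectrumLimit => arrowMap (t.1 (n + 1)) :=
      continuous_arrowMap.comp ((continuous_apply (n + 1)).comp continuous_subtype_val)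
    refine h.congr fun t => ?_
    have hw := (PathSpace.exists_coord_eq t).choose_spec
    rw [← hw (n + 1)]
    exact PathSpace.arrowMap_coord _ n

instance : T2Space S.PathSpace := (pathSpaceHomeo S).symm.t2Space

/-! ### The connected components -/

theorem Path.isConnected_setOf (p : S.Path) :
    IsConnected {z : ∀ n, S.Z n (p.node n) | ∀ n, S.eigenmap (p.y n) (z (n + 1)) = z n} :=
  isConnected_setOf_coherent (X := fun n => S.Z n (p.node n)) fun n => S.eigenmap (p.y n)

instance (p : S.Path) : ConnectedSpace p.InverseLimit :=
  isConnected_iff_connectedSpace.1 p.isConnected_setOf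

instance (p : S.Path) : CompactSpace p.InverseLimit := by
  have h : IsClosed {z : ∀ n, S.Z n (p.node n) | ∀ n, S.eigenmap (p.y n) (z (n + 1)) = z n} := by
    rw [Set.ofPred_forall]
    exact isClosed_iInter fun n => isClosed_eq (by fun_prop) (by fun_prop)
  exact isCompact_iff_compactSpace.1 h.isCompact

/-- The inclusion of the inverse limit along a path in the disjoint union. -/
def Path.incl (p : S.Path) (z : p.InverseLimit) : S.PathSpace := ⟨p, z⟩

theorem Path.continuous_incl (p : S.Path) : Continuous p.incl :=
  continuous_induced_rng.2 (continuous_pi fun n =>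
    (continuous_sigmaMk (σ := fun e : S.Arrow n => S.Z n e.source) (i := p.arrow n)).comp
      ((continuous_apply n).comp continuous_subtype_val))

theorem Path.isEmbedding_incl (p : S.Path) : IsEmbedding p.incl :=
  (p.continuous_incl.isClosedEmbedding fun _ _ h => eq_of_heq (Sigma.mk.inj h).2).isEmbedding

/-- On a connected set the line bundles visited by the path, which vary continuously in a discrete
set, are constant. -/
theorem PathSpace.connectedComponent_eq (w : S.PathSpace) :
    connectedComponent w = Set.range w.1.incl := by
  refine Set.Subset.antisymm (fun w' hw' => ?_)
    ((isPreconnected_range w.1.continuous_incl).subset_connectedComponent ⟨w.2, rfl⟩)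
  have h : w.1 = w'.1 := Path.ext_line fun n => by
    have hc : Continuous fun t : S.Spectrum n => t.1 := continuous_sigma fun _ => continuous_const
    exact isPreconnected_connectedComponent.constant
      (hc.comp (PathSpace.continuous_coord n)).continuousOn mem_connectedComponent hw'
  rcases w with ⟨p, z⟩
  rcases w' with ⟨p', z'⟩
  obtain rfl : p = p' := h
  exact ⟨z', rfl⟩

end GeneralizedDiagonalSystem

end

theorem theorem3p3 (S : GeneralizedDiagonalSystem.{u}) :
    ∃ Φ : WeakDual.characterSpace ℂ S.diagonal ≃ₜ S.PathSpace,
      (∀ p : S.Path, IsEmbedding fun z : p.InverseLimit => Φ.symm ⟨p, z⟩) ∧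
      {K : Set (WeakDual.characterSpace ℂ S.diagonal) | ∃ χ, K = connectedComponent χ} =
        Set.range fun p : S.Path => Set.range fun z : p.InverseLimit => Φ.symm ⟨p, z⟩ := by
  let Φ := S.characterSpaceHomeo.trans S.pathSpaceHomeo.symm
  have hΦ : ∀ w : S.PathSpace, connectedComponent (Φ.symm w) =
      Set.range fun z : w.1.InverseLimit => Φ.symm ⟨w.1, z⟩ := fun w => by
    rw [← connectedComponentIn_univ, ← Set.image_univ_of_surjective Φ.symm.surjective,
      ← Φ.symm.image_connectedComponentIn (Set.mem_univ w), connectedComponentIn_univ,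
      GeneralizedDiagonalSystem.PathSpace.connectedComponent_eq, ← Set.range_comp]
    rfl
  refine ⟨Φ, fun p => Φ.symm.isEmbedding.comp p.isEmbedding_incl, Set.ext fun K => ⟨?_, ?_⟩⟩
  · rintro ⟨χ, rfl⟩
    refine ⟨(Φ χ).1, ?_⟩
    rw [← Φ.symm_apply_apply χ, hΦ, Φ.apply_symm_apply]
  · rintro ⟨p, rfl⟩
    obtain ⟨z⟩ := (inferInstance : Nonempty p.InverseLimit)
    exact ⟨Φ.symm ⟨p, z⟩, (hΦ ⟨p, z⟩).symm⟩
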